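/- Let $(X_i)_{i\ge 1}$ be i.i.d. real random variables with finite second moment whose common law is nonsingular, i.e. of the form $\delta p_c+(1-\delta)p_d$ with $0\le\delta\le 1$, $p_c$ an absolutely continuous and $p_d$ a discrete probability measure on $\mathbb{R}$. Write $X_1^N=(X_1,\dots,X_N)$. For $q\in\mathbb{N}$ let $[x]_q=\lfloor qx\rfloor/q$ (componentwise for vectors). Let $H(D)$ denote the Shannon entropy in bits of a discrete random element $D$, and $H(D\mid Y)$ the average over $y$ of the entropy of the conditional law of $D$ given $Y=y$. Then the Rényi information dimension $$d(X_1)=\lim_{q\to\infty}\frac{H([X_1]_q)}{\log_2 q}$$ exists in $[0,\infty)$, and the following holds. Let $\varepsilon\in\mathbb{R}$, and let $\{\Phi_N\}$ be a family of real matrices, indexed by a subsequence of the positive integers $N$, with $\Phi_N$ of dimension $m_N\times N$. Suppose the family is $\varepsilon$-REP for the law of $X_1$ with measurement rate $\rho\in[0,\infty]$, meaning that $$\limsup_{q\to\infty}\frac{H([X_1^N]_q\mid\Phi_N X_1^N)}{H([X_1^N]_q)}\le\varepsilon\quad\text{for every }N\text{ in the index sequence},\qquad \limsup_{N\to\infty}\frac{m_N}{N}=\rho,$$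 where the ratio $0/0$ is read as $0$. Then $$\rho\ \ge\ d(X_1)\,(1-\varepsilon).$$ -/

import Mathlib

open MeasureTheory ProbabilityTheory Filter Topology
open scoped ENNReal NNReal Matrix

noncomputable section

namespace A2A

/-- Uniform quantization of a real number with step `1 / q`. -/
def quantize (q : ℕ) (x : ℝ) : ℝ := (⌊(q : ℝ) * x⌋ : ℝ) / q

/-- Componentwise uniform quantization of a real vector. -/
def quantizeVec {n : ℕ} (q : ℕ) (x : Fin n → ℝ) : Fin n → ℝ := fun i => quantize q (x i)

/-- Shannon entropy, in bits, of a discrete probability measure (one carried by a countable set):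
the sum over all points of `-p log₂ p`. All terms are nonnegative, so the value lies in
`[0, ∞]`. -/
def entropyOfLaw {α : Type*} [MeasurableSpace α] (μ : Measure α) : ℝ≥0∞ :=
  ∑' x : α, ENNReal.ofReal (Real.negMulLog (μ.real {x}) / Real.log 2)

/-- Shannon entropy `H(D)`, in bits, of a discrete random element `D`. -/
def entropy {Ω α : Type*} [MeasurableSpace Ω] [MeasurableSpace α]
    (P : Measure Ω) (D : Ω → α) : ℝ≥0∞ :=
  entropyOfLaw (P.map D)

/-- Conditional Shannon entropy `H(D | Y)`, in bits, of a discrete random element `D` given an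
arbitrary random element `Y`: the average over `y` of the entropy of the regular conditional
law of `D` given `Y = y`. -/
def condEntropy {Ω α β : Type*} [MeasurableSpace Ω] [MeasurableSpace α] [StandardBorelSpace α]
    [Nonempty α] [MeasurableSpace β] (P : Measure Ω) [IsFiniteMeasure P]
    (D : Ω → α) (Y : Ω → β) : ℝ≥0∞ :=
  ∫⁻ y, entropyOfLaw (condDistrib D Y P y) ∂(P.map Y)

/-- A probability law on the line is nonsingular if it is a mixture `δ p_c + (1 - δ) p_d` of an
absolutely continuous law `p_c` and a discrete law `p_d`, with `0 ≤ δ ≤ 1`. -/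
def IsNonsingular (p : Measure ℝ) : Prop :=
  ∃ (δ : ℝ) (pc pd : Measure ℝ), 0 ≤ δ ∧ δ ≤ 1 ∧
    IsProbabilityMeasure pc ∧ pc ≪ volume ∧
    IsProbabilityMeasure pd ∧ (∃ S : Set ℝ, S.Countable ∧ pd Sᶜ = 0) ∧
    p = ENNReal.ofReal δ • pc + ENNReal.ofReal (1 - δ) • pd

/-- `d` is the Rényi information dimension of the real random variable `X`: the limit of
`H([X]_q) / log₂ q` as `q → ∞` exists and equals `d`. -/
def HasRID {Ω : Type*} [MeasurableSpace Ω] (P : Measure Ω) (X : Ω → ℝ) (d : ℝ≥0) : Prop :=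
  Tendsto (fun q : ℕ => entropy P (fun ω => quantize q (X ω)) / ENNReal.ofReal (Real.logb 2 q))
    atTop (𝓝 (d : ℝ≥0∞))

/-- The block `(X_1, …, X_N)` formed by the first `N` terms of a sequence of random variables. -/
def block {Ω : Type*} (X : ℕ → Ω → ℝ) (N : ℕ) : Ω → Fin N → ℝ := fun ω i => X i ω

/-- A family `{Φ_N}` of real measurement matrices, of dimension `m_N × N`, where `N` runs through a
subsequence `size 0 < size 1 < …` of the positive integers. -/
structure MeasurementFamily where
  size : ℕ → ℕ
  size_pos : ∀ k, 0 < size k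
  size_strictMono : StrictMono size
  rows : ℕ → ℕ
  mat : ∀ k, Matrix (Fin (rows k)) (Fin (size k)) ℝ

/-- The asymptotic measurement rate `limsup_{N → ∞} m_N / N`, with values in `[0, ∞]`. -/
def MeasurementFamily.rate (F : MeasurementFamily) : EReal :=
  limsup (fun k => (((F.rows k : ℝ) / (F.size k : ℝ) : ℝ) : EReal)) atTop

/-- The family is `ε`-REP for the source `X_1, X_2, …`, with measurement rate `ρ`: for every `N` in
the index sequence, `limsup_{q → ∞} H([X_1^N]_q | Φ_N X_1^N) / H([X_1^N]_q) ≤ ε`, and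
`limsup_{N → ∞} m_N / N = ρ`. -/
def MeasurementFamily.IsREP {Ω : Type*} [MeasurableSpace Ω] (F : MeasurementFamily)
    (P : Measure Ω) [IsFiniteMeasure P] (X : ℕ → Ω → ℝ) (ε : ℝ) (ρ : EReal) : Prop :=
  (∀ k,
    limsup (fun q : ℕ =>
      ((condEntropy P (fun ω => quantizeVec q (block X (F.size k) ω))
          (fun ω => F.mat k *ᵥ block X (F.size k) ω)
        / entropy P (fun ω => quantizeVec q (block X (F.size k) ω)) : ℝ≥0∞) : EReal)) atTop
      ≤ (ε : EReal)) ∧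
  F.rate = ρ

end A2A

end

/-! Let `S` be a countable set off which the law `p` is absolutely continuous. The dimension is `d =
p Sᶜ`, and the inequality comes from comparing two entropy estimates, both on the scale of `log₂ q`.

Lower bound (`lower_bound`). Read a conditional law as a strategy `κ` that guesses the quantized
vector from `Φ x`; the entropy is the mean surprisal of the correct answer. If `T` is the set of
coordinates lying outside `S`, the vectors supported in `T` and killed by `Φ` form a space `K` of
dimension at least `|T| - m`. Moving `x` along `K` leaves `Φ x` unchanged but sweeps many grid
cells, so the average probability of a correct guess is of order at most `q ^ (-dim K)`. Hence
outside a set of vanishing probability the surprisal is at least `(|T| - m - t) log₂ q`, and `|T|`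
has mean `N d`.

Upper bound (`scalar_upper_bound`, `upper_bound`). By Gibbs' inequality entropy is at most cross
entropy relative to any law. A half-half mixture of `p` and a Gaussian charges every atom by an
amount independent of `q`, and every cell by about `1 / q`. The cross entropy per coordinate is thus
at most about `d log₂ q`, the second moment supplying domination.

If `c` is the conditional entropy and `e` the entropy of the block, then `c ≥ (N d - m - t) log₂ q`,
`e ≤ N (d + t) log₂ q` and `c ≤ ε' e` with `ε'` slightly above `ε`. Letting `t → 0` and `ε' → ε`
gives `m / N ≥ d (1 - ε)` for each single `N`. -/

namespace A2A

/-! ### Surprisal and Gibbs' inequality. -/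

/-- The information content, in bits, of an event of probability `a`. -/
noncomputable def surprisal (a : ℝ≥0∞) : ℝ≥0∞ :=
  if a = 0 then ⊤ else ENNReal.ofReal (-Real.logb 2 a.toReal)

theorem measurable_surprisal : Measurable surprisal := by
  unfold surprisal
  refine Measurable.ite (measurableSet_singleton 0) measurable_const ?_
  exact ((Real.measurable_log.comp ENNReal.measurable_toReal).div_const _).neg.ennreal_ofReal

theorem surprisal_anti {a b : ℝ≥0∞} (hab : a ≤ b) (hb : b ≠ ⊤) : surprisal b ≤ surprisal a := by
  unfold surprisal
  by_cases ha : a = 0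
  · simp [ha]
  have hb0 : b ≠ 0 := fun h => ha (le_antisymm (h ▸ hab) bot_le)
  rw [if_neg ha, if_neg hb0]
  refine ENNReal.ofReal_le_ofReal (neg_le_neg ?_)
  exact Real.logb_le_logb_of_le (by norm_num)
    (ENNReal.toReal_pos ha (ne_top_of_le_ne_top hb hab)) (ENNReal.toReal_mono hb hab)

theorem ofReal_sum_le {ι : Type*} (s : Finset ι) (f : ι → ℝ) :
    ENNReal.ofReal (∑ i ∈ s, f i) ≤ ∑ i ∈ s, ENNReal.ofReal (f i) := by
  classical
  induction s using Finset.induction_on with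
  | empty => simp
  | insert i s hi ih =>
    rw [Finset.sum_insert hi, Finset.sum_insert hi]
    exact ENNReal.ofReal_add_le.trans (by gcongr)

theorem surprisal_prod_le {ι : Type*} (s : Finset ι) (a : ι → ℝ≥0∞) (ha : ∀ i, a i ≠ ⊤) :
    surprisal (∏ i ∈ s, a i) ≤ ∑ i ∈ s, surprisal (a i) := by
  by_cases h : ∃ i ∈ s, a i = 0
  · obtain ⟨i, hi, h0⟩ := h
    have : surprisal (a i) = ⊤ := by simp [surprisal, h0]
    rw [ENNReal.sum_eq_top.2 ⟨i, hi, this⟩]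
    exact le_top
  · push Not at h
    have hp : ∏ i ∈ s, a i ≠ 0 := Finset.prod_ne_zero_iff.2 h
    rw [surprisal, if_neg hp, ENNReal.toReal_prod, Real.logb_prod, ← Finset.sum_neg_distrib]
    · refine (ofReal_sum_le _ _).trans_eq (Finset.sum_congr rfl fun i hi => ?_)
      rw [surprisal, if_neg (h i hi)]
    · exact fun i hi => (ENNReal.toReal_pos (h i hi) (ha i)).ne'

theorem surprisal_mul_self {a : ℝ≥0∞} (ha : a ≤ 1) :
    surprisal a * a = ENNReal.ofReal (Real.negMulLog a.toReal / Real.log 2) := by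
  by_cases h : a = 0
  · simp [h]
  have hat : a ≠ ⊤ := ne_top_of_le_ne_top ENNReal.one_ne_top ha
  have h1 : a.toReal ≤ 1 := by simpa using ENNReal.toReal_mono ENNReal.one_ne_top ha
  rw [surprisal, if_neg h]
  nth_rw 2 [← ENNReal.ofReal_toReal hat]
  rw [← ENNReal.ofReal_mul', Real.negMulLog, Real.logb]
  · congr 1; ring
  · exact ENNReal.toReal_nonneg

theorem lintegral_eq_tsum_singleton {α : Type*} [MeasurableSpace α] [MeasurableSingletonClass α]
    (μ : Measure α) {C : Set α} (hC : C.Countable) (hμ : μ Cᶜ = 0) (f : α → ℝ≥0∞) :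
    ∫⁻ x, f x ∂μ = ∑' x, f x * μ {x} := by
  have hr : μ.restrict C = μ := Measure.restrict_eq_self_of_ae_mem hμ
  conv_lhs => rw [← hr]
  rw [lintegral_countable f hC]
  refine tsum_subtype_eq_of_support_subset (f := fun x => f x * μ {x}) fun x hx => ?_
  by_contra hxC
  apply hx
  have : μ {x} = 0 := measure_mono_null (by simpa using hxC) hμ
  simp [this]

theorem entropyOfLaw_eq_lintegral {α : Type*} [MeasurableSpace α] [MeasurableSingletonClass α]
    (μ : Measure α) [IsProbabilityMeasure μ] {C : Set α} (hC : C.Countable) (hμ : μ Cᶜ = 0) :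
    entropyOfLaw μ = ∫⁻ x, surprisal (μ {x}) ∂μ := by
  rw [lintegral_eq_tsum_singleton μ hC hμ, entropyOfLaw]
  exact tsum_congr fun x => (surprisal_mul_self prob_le_one).symm

/-- Pointwise Gibbs inequality, from `log (r / p) ≤ r / p - 1`. The linear terms stand on both sides
as sums because subtraction in `ℝ≥0∞` truncates. -/
theorem surprisal_mul_self_add_le {p r : ℝ≥0∞} (hp : p ≤ 1) (hr : r ≤ 1) :
    surprisal p * p + ENNReal.ofReal (Real.log 2)⁻¹ * p ≤
      surprisal r * p + ENNReal.ofReal (Real.log 2)⁻¹ * r := by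
  by_cases hp0 : p = 0
  · simp [hp0]
  by_cases hr0 : r = 0
  · simp [surprisal, hr0, ENNReal.top_mul hp0]
  have hpt : p ≠ ⊤ := ne_top_of_le_ne_top ENNReal.one_ne_top hp
  have hrt : r ≠ ⊤ := ne_top_of_le_ne_top ENNReal.one_ne_top hr
  rw [surprisal_mul_self hp, surprisal, if_neg hr0]
  set x := p.toReal with hx
  set y := r.toReal with hy
  have hx0 : 0 < x := ENNReal.toReal_pos hp0 hpt
  have hy0 : 0 < y := ENNReal.toReal_pos hr0 hrt
  have hx1 : x ≤ 1 := by simpa using ENNReal.toReal_mono ENNReal.one_ne_top hp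
  have hy1 : y ≤ 1 := by simpa using ENNReal.toReal_mono ENNReal.one_ne_top hr
  have hl : 0 < Real.log 2 := Real.log_pos (by norm_num)
  rw [← ENNReal.ofReal_toReal hpt, ← ENNReal.ofReal_toReal hrt, ← hx, ← hy]
  have h1 : 0 ≤ -Real.logb 2 y := by
    have := Real.logb_nonpos (b := 2) (by norm_num) hy0.le hy1
    linarith
  have h2 : 0 ≤ Real.negMulLog x := Real.negMulLog_nonneg hx0.le hx1
  rw [← ENNReal.ofReal_mul (by positivity), ← ENNReal.ofReal_mul h1,
    ← ENNReal.ofReal_mul (by positivity), ← ENNReal.ofReal_add (by positivity) (by positivity),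
    ← ENNReal.ofReal_add (by positivity) (by positivity)]
  refine ENNReal.ofReal_le_ofReal ?_
  have h3 := Real.log_le_sub_one_of_pos (div_pos hy0 hx0)
  rw [Real.log_div hy0.ne' hx0.ne'] at h3
  have h4 : x * (Real.log y - Real.log x) ≤ y - x := by
    calc x * (Real.log y - Real.log x) ≤ x * (y / x - 1) := by gcongr
      _ = y - x := by field_simp
  rw [Real.negMulLog, Real.logb]
  have : -x * Real.log x / Real.log 2 + (Real.log 2)⁻¹ * x
      = (-x * Real.log x + x) * (Real.log 2)⁻¹ := by ring
  rw [this]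
  have : -(Real.log y / Real.log 2) * x + (Real.log 2)⁻¹ * y
      = (-(Real.log y) * x + y) * (Real.log 2)⁻¹ := by ring
  rw [this]
  exact mul_le_mul_of_nonneg_right (by linarith) (by positivity)

/-- Gibbs' inequality: the entropy is at most the cross entropy relative to any other law. -/
theorem entropyOfLaw_le_lintegral_surprisal {α : Type*} [MeasurableSpace α]
    [MeasurableSingletonClass α] (μ R : Measure α) [IsProbabilityMeasure μ]
    [IsProbabilityMeasure R] {C : Set α} (hC : C.Countable) (hμ : μ Cᶜ = 0) :
    entropyOfLaw μ ≤ ∫⁻ x, surprisal (R {x}) ∂μ := by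
  rw [entropyOfLaw_eq_lintegral μ hC hμ, lintegral_eq_tsum_singleton μ hC hμ,
    lintegral_eq_tsum_singleton μ hC hμ]
  set c := ENNReal.ofReal (Real.log 2)⁻¹
  have hs : ∑' x, μ {x} = 1 := by
    have := lintegral_eq_tsum_singleton μ hC hμ (fun _ => 1)
    simpa using this.symm
  -- `R` may have a diffuse part, so its point masses need not add up to one; only this direction
  -- matters.
  have hR : ∑' x, R {x} ≤ 1 := by
    refine (tsum_meas_le_meas_iUnion_of_disjoint R (fun x => measurableSet_singleton x)
      fun x y hxy => ?_).trans prob_le_one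
    simpa using hxy
  refine (ENNReal.add_le_add_iff_right (a := c) ENNReal.ofReal_ne_top).1 ?_
  calc ∑' x, surprisal (μ {x}) * μ {x} + c
      = ∑' x, (surprisal (μ {x}) * μ {x} + c * μ {x}) := by
        rw [ENNReal.tsum_add, ENNReal.tsum_mul_left, hs, mul_one]
    _ ≤ ∑' x, (surprisal (R {x}) * μ {x} + c * R {x}) :=
        ENNReal.tsum_le_tsum fun x => surprisal_mul_self_add_le prob_le_one prob_le_one
    _ = ∑' x, surprisal (R {x}) * μ {x} + c * ∑' x, R {x} := by
        rw [ENNReal.tsum_add, ENNReal.tsum_mul_left]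
    _ ≤ ∑' x, surprisal (R {x}) * μ {x} + c := by
        gcongr
        exact mul_le_of_le_one_right bot_le hR

/-! ### Quantization, and entropies as expected surprisals. -/

theorem measurable_quantize (q : ℕ) : Measurable (quantize q) := by
  unfold quantize
  fun_prop

theorem measurable_quantizeVec {n : ℕ} (q : ℕ) : Measurable (quantizeVec (n := n) q) :=
  measurable_pi_lambda _ fun i => (measurable_quantize q).comp (measurable_pi_apply i)

theorem countable_range_quantize (q : ℕ) : (Set.range (quantize q)).Countable := by
  refine (Set.countable_range fun z : ℤ => (z : ℝ) / q).mono ?_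
  rintro _ ⟨x, rfl⟩
  exact ⟨⌊(q : ℝ) * x⌋, rfl⟩

theorem countable_range_quantizeVec {n : ℕ} (q : ℕ) :
    (Set.range (quantizeVec (n := n) q)).Countable := by
  refine (Set.countable_univ_pi fun _ => countable_range_quantize q).mono ?_
  rintro _ ⟨x, rfl⟩ i -
  exact ⟨x i, rfl⟩

theorem abs_sub_le_of_quantize_eq {q : ℕ} (hq : 0 < q) {x y : ℝ}
    (h : quantize q x = quantize q y) : |x - y| ≤ 1 / q := by
  have hq' : (0 : ℝ) < q := by exact_mod_cast hq
  have hf : ⌊(q : ℝ) * x⌋ = ⌊(q : ℝ) * y⌋ := by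
    unfold quantize at h
    rw [div_left_inj' hq'.ne'] at h
    exact_mod_cast h
  have := Int.abs_sub_lt_one_of_floor_eq_floor hf
  rw [← mul_sub, abs_mul, abs_of_pos hq'] at this
  rw [le_div_iff₀ hq']
  linarith

theorem measurable_kernel_singleton {α β : Type*} [MeasurableSpace α] [MeasurableSpace β]
    [MeasurableEq β] (κ : Kernel α β) [IsFiniteKernel κ] :
    Measurable fun p : α × β => κ p.1 {p.2} := by
  have h := Kernel.measurable_kernel_prodMk_left
    (κ := κ.comap (Prod.fst : α × β → α) measurable_fst)
    (t := {p : (α × β) × β | p.2 = p.1.2})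
    (measurableSet_eq_fun measurable_snd (measurable_snd.comp measurable_fst))
  exact h

theorem measurable_measure_singleton {β : Type*} [MeasurableSpace β]
    [MeasurableEq β] (μ : Measure β) [SFinite μ] :
    Measurable fun x : β => μ {x} := by
  exact measurable_measure_prodMk_left (ν := μ) (s := {p : β × β | p.2 = p.1})
    (measurableSet_eq_fun measurable_snd measurable_fst)

theorem entropy_eq_lintegral {Ω α : Type*} [MeasurableSpace Ω] [MeasurableSpace α]
    [MeasurableSingletonClass α] [MeasurableEq α] (P : Measure Ω) [IsProbabilityMeasure P]
    {D : Ω → α} (hD : Measurable D) {C : Set α} (hC : C.Countable) (hDC : ∀ ω, D ω ∈ C) :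
    entropy P D = ∫⁻ ω, surprisal (P.map D {D ω}) ∂P := by
  have : IsProbabilityMeasure (P.map D) := Measure.isProbabilityMeasure_map hD.aemeasurable
  rw [entropy, entropyOfLaw_eq_lintegral _ hC, lintegral_map _ hD]
  · exact measurable_surprisal.comp (measurable_measure_singleton _)
  · rw [Measure.map_apply hD hC.measurableSet.compl]
    simp [Set.preimage, hDC]

theorem entropy_le_lintegral {Ω α : Type*} [MeasurableSpace Ω] [MeasurableSpace α]
    [MeasurableSingletonClass α] [MeasurableEq α] (P : Measure Ω) [IsProbabilityMeasure P]
    (R : Measure α) [IsProbabilityMeasure R]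
    {D : Ω → α} (hD : Measurable D) {C : Set α} (hC : C.Countable) (hDC : ∀ ω, D ω ∈ C) :
    entropy P D ≤ ∫⁻ ω, surprisal (R {D ω}) ∂P := by
  have : IsProbabilityMeasure (P.map D) := Measure.isProbabilityMeasure_map hD.aemeasurable
  rw [← lintegral_map (f := fun x => surprisal (R {x})) _ hD]
  · refine entropyOfLaw_le_lintegral_surprisal _ R hC ?_
    rw [Measure.map_apply hD hC.measurableSet.compl]
    simp [Set.preimage, hDC]
  · exact measurable_surprisal.comp (measurable_measure_singleton _)

/-- Disintegration collapses the nested average into one expectation over `Ω`. In this form the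
conditional law is merely one guessing kernel evaluated at `Y ω`. -/
theorem condEntropy_eq_lintegral {Ω α β : Type*} [MeasurableSpace Ω] [MeasurableSpace α]
    [StandardBorelSpace α] [Nonempty α] [MeasurableSpace β] (P : Measure Ω)
    [IsProbabilityMeasure P] {D : Ω → α} {Y : Ω → β} (hD : Measurable D) (hY : Measurable Y)
    {C : Set α} (hC : C.Countable) (hDC : ∀ ω, D ω ∈ C) :
    condEntropy P D Y = ∫⁻ ω, surprisal (condDistrib D Y P (Y ω) {D ω}) ∂P := by
  have hc : (P.map Y) ⊗ₘ condDistrib D Y P = P.map fun ω => (Y ω, D ω) :=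
    compProd_map_condDistrib hD.aemeasurable
  have hm : Measurable fun p : β × α => surprisal (condDistrib D Y P p.1 {p.2}) :=
    measurable_surprisal.comp (measurable_kernel_singleton _)
  have hae : ∀ᵐ y ∂(P.map Y), condDistrib D Y P y Cᶜ = 0 := by
    have : ∀ᵐ p ∂((P.map Y) ⊗ₘ condDistrib D Y P), p.2 ∈ C := by
      rw [hc, ae_map_iff (hY.prodMk hD).aemeasurable (measurable_snd hC.measurableSet)]
      exact Eventually.of_forall hDC
    exact Measure.ae_ae_of_ae_compProd this
  have h1 : condEntropy P D Y
      = ∫⁻ y, ∫⁻ d, surprisal (condDistrib D Y P y {d}) ∂(condDistrib D Y P y) ∂(P.map Y) := by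
    refine lintegral_congr_ae ?_
    filter_upwards [hae] with y hy
    exact entropyOfLaw_eq_lintegral _ hC hy
  rw [h1, ← Measure.lintegral_compProd (f := fun p => surprisal (condDistrib D Y P p.1 {p.2})) hm,
    hc, lintegral_map hm (hY.prodMk hD)]

/-! ### Guessing probabilities along the kernel of the measurements. -/

theorem norm_sub_le_of_quantizeVec_eq {n q : ℕ} (hq : 0 < q) {x y : Fin n → ℝ}
    (h : quantizeVec q x = quantizeVec q y) : ‖x - y‖ ≤ 1 / q := by
  refine (pi_norm_le_iff_of_nonneg (by positivity)).2 fun i => ?_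
  exact abs_sub_le_of_quantize_eq hq (congrFun h i)

/-- A random point of a grid coincides with the quantization of a point of a translate of `K`
only on a set of small Haar measure. -/
theorem lintegral_singleton_quantizeVec_add_le {n q : ℕ} (hq : 0 < q)
    (K : Submodule ℝ (Fin n → ℝ)) (σ : Measure K) [σ.IsAddHaarMeasure]
    (ρ : Measure (Fin n → ℝ)) [IsProbabilityMeasure ρ] (x : Fin n → ℝ) :
    ∫⁻ v : K, ρ {quantizeVec q (x + (v : Fin n → ℝ))} ∂σ ≤ σ (Metric.closedBall 0 (1 / q)) := by
  set s : Set (K × (Fin n → ℝ)) := {p | p.2 = quantizeVec q (x + (p.1 : Fin n → ℝ))} with hs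
  have hsm : MeasurableSet s := by
    refine measurableSet_eq_fun measurable_snd ((measurable_quantizeVec q).comp ?_)
    exact measurable_const.add (measurable_subtype_coe.comp measurable_fst)
  have h1 : ∫⁻ v : K, ρ {quantizeVec q (x + (v : Fin n → ℝ))} ∂σ = (σ.prod ρ) s := by
    rw [Measure.prod_apply hsm]
    rfl
  rw [h1, Measure.prod_apply_symm hsm]
  -- After Fubini the guess `d` is fixed. Two vectors `v` for which `d` is correct differ by at most
  -- `1 / q`, so the slice lies in a ball about any of its points.
  refine (lintegral_mono (g := fun _ => σ (Metric.closedBall 0 (1 / q))) fun d => ?_).trans ?_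
  · by_cases hd : ((fun v => (v, d)) ⁻¹' s).Nonempty
    · obtain ⟨v₀, hv₀⟩ := hd
      rw [← Measure.addHaar_closedBall_center σ v₀]
      refine measure_mono fun v hv => ?_
      rw [Metric.mem_closedBall, dist_eq_norm]
      have h : quantizeVec q (x + (v : Fin n → ℝ)) = quantizeVec q (x + (v₀ : Fin n → ℝ)) :=
        Eq.trans (Eq.symm hv) hv₀
      have := norm_sub_le_of_quantizeVec_eq hq h
      rwa [add_sub_add_left_eq_sub] at this
    · rw [Set.not_nonempty_iff_eq_empty.1 hd]
      simp
  · simp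

/-- Invariance of `ν` allows averaging over translations by the unit ball of `K`, which enlarges the
radius `R` to `R + 1`. Along a translate of `K` the guessing law is constant, so the inner integral
is at most the Haar measure of a ball of radius `1 / q`, and scaling produces the exponent `dim K`.
-/
theorem setLIntegral_kernel_quantizeVec_le {n m q : ℕ} (hq : 0 < q)
    (Φ : Matrix (Fin m) (Fin n) ℝ) (K : Submodule ℝ (Fin n → ℝ)) (hK : ∀ v ∈ K, Φ *ᵥ v = 0)
    (ν : Measure (Fin n → ℝ)) [SFinite ν] (hν : ∀ v ∈ K, MeasurePreserving (fun x => x + v) ν ν)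
    (κ : Kernel (Fin m → ℝ) (Fin n → ℝ)) [IsMarkovKernel κ] (R : ℝ) :
    ∫⁻ x in Metric.closedBall 0 R, κ (Φ *ᵥ x) {quantizeVec q x} ∂ν ≤
      ν (Metric.closedBall 0 (R + 1)) *
        ENNReal.ofReal ((1 / (q : ℝ)) ^ Module.finrank ℝ K) := by
  have hΦ : Measurable fun x : Fin n → ℝ => Φ *ᵥ x :=
    (Continuous.matrix_mulVec continuous_const continuous_id).measurable
  have hg : Measurable fun x : Fin n → ℝ => κ (Φ *ᵥ x) {quantizeVec q x} :=
    (measurable_kernel_singleton κ).comp (hΦ.prodMk (measurable_quantizeVec q))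
  set F : (Fin n → ℝ) → ℝ≥0∞ :=
    (Metric.closedBall 0 R).indicator fun x => κ (Φ *ᵥ x) {quantizeVec q x} with hF
  have hFm : Measurable F := hg.indicator measurableSet_closedBall
  set σ : Measure K := Measure.addHaar
  set b := σ (Metric.closedBall 0 1) with hb
  have hb0 : b ≠ 0 := (Metric.measure_closedBall_pos σ 0 one_pos).ne'
  have hbt : b ≠ ⊤ := measure_closedBall_lt_top.ne
  rw [← lintegral_indicator measurableSet_closedBall]
  refine (ENNReal.mul_le_mul_iff_right hb0 hbt).1 ?_
  calc b * ∫⁻ x, F x ∂ν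
      = ∫⁻ v in Metric.closedBall (0 : K) 1, ∫⁻ x, F (x + (v : Fin n → ℝ)) ∂ν ∂σ := by
        have : ∀ v : K, ∫⁻ x, F (x + (v : Fin n → ℝ)) ∂ν = ∫⁻ x, F x ∂ν :=
          fun v => (hν v v.2).lintegral_comp hFm
        simp_rw [this]
        rw [setLIntegral_const, mul_comm]
    _ = ∫⁻ x, ∫⁻ v in Metric.closedBall (0 : K) 1, F (x + (v : Fin n → ℝ)) ∂σ ∂ν := by
        refine lintegral_lintegral_swap (Measurable.aemeasurable (hFm.comp ?_))
        exact measurable_snd.add (measurable_subtype_coe.comp measurable_fst)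
    _ ≤ ∫⁻ x, (Metric.closedBall (0 : Fin n → ℝ) (R + 1)).indicator
          (fun _ => σ (Metric.closedBall 0 (1 / q))) x ∂ν := by
        refine lintegral_mono fun x => ?_
        by_cases hx : x ∈ Metric.closedBall (0 : Fin n → ℝ) (R + 1)
        · rw [Set.indicator_of_mem hx]
          refine le_trans ?_ (lintegral_singleton_quantizeVec_add_le hq K σ (κ (Φ *ᵥ x)) x)
          refine (setLIntegral_le_lintegral _ _).trans (lintegral_mono fun v => ?_)
          refine (Set.indicator_le_self _ _ _).trans_eq ?_
          simp only [Matrix.mulVec_add, hK v v.2, add_zero]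
        · rw [Set.indicator_of_notMem hx, nonpos_iff_eq_zero,
            setLIntegral_congr_fun (g := fun _ => 0) measurableSet_closedBall]
          · simp
          · intro v hv
            refine Set.indicator_of_notMem (fun h => hx ?_) _
            rw [mem_closedBall_zero_iff] at h hv ⊢
            have h2 : ‖x‖ ≤ ‖x + (v : Fin n → ℝ)‖ + ‖(v : Fin n → ℝ)‖ := by
              simpa using norm_sub_le (x + (v : Fin n → ℝ)) v
            have h3 : ‖(v : Fin n → ℝ)‖ ≤ 1 := hv
            linarith
    _ = b * (ν (Metric.closedBall 0 (R + 1)) *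
        ENNReal.ofReal ((1 / (q : ℝ)) ^ Module.finrank ℝ K)) := by
        rw [lintegral_indicator measurableSet_closedBall, setLIntegral_const,
          Measure.addHaar_closedBall' σ 0 (by positivity : (0 : ℝ) ≤ 1 / q)]
        ring

/-- The vectors supported in `T` and killed by `Φ`. -/
def kernelOn {n m : ℕ} (Φ : Matrix (Fin m) (Fin n) ℝ) (T : Finset (Fin n)) :
    Submodule ℝ (Fin n → ℝ) :=
  LinearMap.ker ((LinearMap.funLeft ℝ ℝ (Subtype.val : {i // i ∉ T} → Fin n)).prod Φ.mulVecLin)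

theorem mem_kernelOn {n m : ℕ} {Φ : Matrix (Fin m) (Fin n) ℝ} {T : Finset (Fin n)}
    {v : Fin n → ℝ} : v ∈ kernelOn Φ T ↔ (∀ i ∉ T, v i = 0) ∧ Φ *ᵥ v = 0 := by
  simp [kernelOn, funext_iff, LinearMap.funLeft]

/-- Rank-nullity: the conditions defining the kernel take values in a space of dimension `(n - |T|)
+ m`. -/
theorem card_le_add_finrank_kernelOn {n m : ℕ} (Φ : Matrix (Fin m) (Fin n) ℝ)
    (T : Finset (Fin n)) : T.card ≤ m + Module.finrank ℝ (kernelOn Φ T) := by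
  have h := LinearMap.finrank_range_add_finrank_ker
    ((LinearMap.funLeft ℝ ℝ (Subtype.val : {i // i ∉ T} → Fin n)).prod Φ.mulVecLin)
  have h2 := Submodule.finrank_le (LinearMap.range
    ((LinearMap.funLeft ℝ ℝ (Subtype.val : {i // i ∉ T} → Fin n)).prod Φ.mulVecLin))
  rw [Module.finrank_prod, Module.finrank_fintype_fun_eq_card, Module.finrank_fintype_fun_eq_card,
    Fintype.card_fin, Fintype.card_subtype_compl, Fintype.card_fin, Fintype.card_coe] at h2
  rw [Module.finrank_fintype_fun_eq_card, Fintype.card_fin] at h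
  have h3 : T.card ≤ n := by simpa using T.card_le_univ
  unfold kernelOn
  omega

theorem pi_absolutelyContinuous_pi {n : ℕ} (μ ν : Fin n → Measure ℝ) [∀ i, SigmaFinite (μ i)]
    [∀ i, SigmaFinite (ν i)] (h : ∀ i, μ i ≪ ν i) : Measure.pi μ ≪ Measure.pi ν := by
  induction n with
  | zero => rw [Measure.pi_of_empty μ 0, Measure.pi_of_empty ν 0]
  | succ n ih =>
    have hμ := (measurePreserving_piFinSuccAbove μ 0).symm
    have hν := (measurePreserving_piFinSuccAbove ν 0).symm
    rw [← hμ.map_eq, ← hν.map_eq]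
    exact ((h 0).prod (ih _ _ fun i => h _)).map hμ.measurable

/-- A finite measure absolutely continuous with respect to `ν` is small on sets of small
`ν`-measure. -/
theorem tendsto_measure_zero_of_absolutelyContinuous {α ι : Type*} [MeasurableSpace α]
    {μ ν : Measure α} [IsFiniteMeasure μ] [SigmaFinite ν] (h : μ ≪ ν) {l : Filter ι}
    {s : ι → Set α} (hsm : ∀ i, MeasurableSet (s i))
    (hs : Tendsto (fun i => ν (s i)) l (𝓝 0)) : Tendsto (fun i => μ (s i)) l (𝓝 0) := by
  have hd := Measure.withDensity_rnDeriv_eq μ ν h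
  have : ∀ i, μ (s i) = ∫⁻ x in s i, μ.rnDeriv ν x ∂ν := fun i => by
    rw [← withDensity_apply _ (hsm i), hd]
  simp_rw [this]
  refine tendsto_setLIntegral_zero ?_ hs
  exact (Measure.lintegral_rnDeriv_lt_top μ ν).ne

/-- Turns an easy guess into the pointwise inequality needed for Markov's inequality. The hypothesis
is additive to avoid truncated subtraction when `k < m`. -/
theorem one_le_rpow_mul_of_surprisal_lt {a : ℝ≥0∞} (ha : a ≤ 1) {q : ℕ} (hq : 2 ≤ q)
    {m k : ℕ} {t : ℝ≥0}
    (h : surprisal a / ENNReal.ofReal (Real.logb 2 q) + t + m < k) :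
    1 ≤ ENNReal.ofReal ((q : ℝ) ^ ((k : ℝ) - m - t)) * a := by
  have hq1 : (1 : ℝ) < q := by exact_mod_cast hq
  have hl : 0 < Real.logb 2 q := Real.logb_pos (by norm_num) hq1
  have hat : a ≠ ⊤ := ne_top_of_le_ne_top ENNReal.one_ne_top ha
  by_cases ha0 : a = 0
  · have : (⊤ : ℝ≥0∞) / ENNReal.ofReal (Real.logb 2 q) = ⊤ := ENNReal.top_div_of_ne_top (by simp)
    simp [surprisal, ha0, this] at h
  rw [surprisal, if_neg ha0, ← ENNReal.ofReal_div_of_pos hl] at h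
  have h1 : -Real.logb 2 a.toReal / Real.logb 2 q + t + m < k := by
    have h2 := ENNReal.toReal_strict_mono (by simp) h
    rw [ENNReal.toReal_add (by simp) (by simp), ENNReal.toReal_add (by simp) (by simp),
      ENNReal.toReal_ofReal'] at h2
    simp only [ENNReal.coe_toReal, ENNReal.toReal_natCast] at h2
    have := le_max_left (-Real.logb 2 a.toReal / Real.logb 2 q) 0
    linarith
  have h3 : -Real.logb 2 a.toReal ≤ ((k : ℝ) - m - t) * Real.logb 2 q := by
    rw [← div_le_iff₀ hl]
    linarith
  have ha' : 0 < a.toReal := ENNReal.toReal_pos ha0 hat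
  have h4 : (q : ℝ) ^ (-((k : ℝ) - m - t)) ≤ a.toReal := by
    rw [← Real.logb_le_logb (b := 2) (by norm_num) (by positivity) ha',
      Real.logb_rpow_eq_mul_logb_of_pos (by positivity)]
    linarith
  calc (1 : ℝ≥0∞) = ENNReal.ofReal ((q : ℝ) ^ ((k : ℝ) - m - t)) *
        ENNReal.ofReal ((q : ℝ) ^ (-((k : ℝ) - m - t))) := by
        rw [← ENNReal.ofReal_mul (by positivity), ← Real.rpow_add (by positivity)]
        simp
    _ ≤ _ := by
        gcongr
        exact ENNReal.ofReal_le_of_le_toReal h4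

theorem tendsto_measure_compl_closedBall {n : ℕ} (μ : Measure (Fin n → ℝ)) [IsFiniteMeasure μ] :
    Tendsto (fun R : ℕ => μ (Metric.closedBall 0 (R : ℝ))ᶜ) atTop (𝓝 0) := by
  have h := tendsto_measure_iInter_atTop (μ := μ)
    (s := fun R : ℕ => (Metric.closedBall (0 : Fin n → ℝ) (R : ℝ))ᶜ)
    (fun R => measurableSet_closedBall.compl.nullMeasurableSet)
    (fun a b hab => Set.compl_subset_compl.2
      (Metric.closedBall_subset_closedBall (by exact_mod_cast hab)))
    ⟨0, measure_ne_top _ _⟩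
  have h0 : ⋂ R : ℕ, (Metric.closedBall (0 : Fin n → ℝ) (R : ℝ))ᶜ = ∅ := by
    rw [← Set.compl_iUnion, Metric.iUnion_closedBall_nat, Set.compl_univ]
  rwa [h0, measure_empty] at h

/-! ### Lower bound for the mean surprisal of any guessing strategy. -/

section LowerBound

variable {n m : ℕ} (Φ : Matrix (Fin m) (Fin n) ℝ)
  (κ : ℕ → Kernel (Fin m → ℝ) (Fin n → ℝ)) [∀ q, IsMarkovKernel (κ q)]

theorem measurable_kernel_mulVec_quantizeVec (q : ℕ) :
    Measurable fun x : Fin n → ℝ => κ q (Φ *ᵥ x) {quantizeVec q x} :=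
  (measurable_kernel_singleton (κ q)).comp
    ((Continuous.matrix_mulVec continuous_const continuous_id).measurable.prodMk
      (measurable_quantizeVec q))

theorem measurable_surprisal_kernel (q : ℕ) :
    Measurable fun x : Fin n → ℝ => surprisal (κ q (Φ *ᵥ x) {quantizeVec q x}) :=
  measurable_surprisal.comp (measurable_kernel_mulVec_quantizeVec Φ κ q)

/-- The points whose quantization is easier to guess, with the strategy `κ`, than dimension `k`
permits after `m` linear measurements. -/
def guessableSet (t : ℝ≥0) (k : ℕ) (q : ℕ) : Set (Fin n → ℝ) :=
  {x | surprisal (κ q (Φ *ᵥ x) {quantizeVec q x}) / ENNReal.ofReal (Real.logb 2 q) + t + m < k}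

theorem measurableSet_guessableSet (t : ℝ≥0) (k q : ℕ) :
    MeasurableSet (guessableSet Φ κ t k q) := by
  refine measurableSet_lt ?_ measurable_const
  exact (((measurable_surprisal_kernel Φ κ q).div_const _).add_const _).add_const _

/-- Markov's inequality: the threshold contributes `q ^ (|T| - m - t)` and the averaged guess `q ^
(-dim K)`; since `|T| ≤ m + dim K`, a factor `q ^ (-t)` remains. -/
theorem measure_guessableSet_inter_le {T : Finset (Fin n)} (t : ℝ≥0) {q : ℕ} (hq : 2 ≤ q)
    (ν : Measure (Fin n → ℝ)) [SFinite ν]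
    (hν : ∀ v ∈ kernelOn Φ T, MeasurePreserving (fun x => x + v) ν ν) (R : ℝ) :
    ν (guessableSet Φ κ t T.card q ∩ Metric.closedBall 0 R) ≤
      ν (Metric.closedBall 0 (R + 1)) * ENNReal.ofReal ((q : ℝ) ^ (-(t : ℝ))) := by
  have hq0 : (0 : ℝ) < q := by positivity
  have hq1 : (1 : ℝ) ≤ q := by exact_mod_cast (by omega : 1 ≤ q)
  set E := guessableSet Φ κ t T.card q
  have hE : MeasurableSet E := measurableSet_guessableSet Φ κ t T.card q
  set c := ENNReal.ofReal ((q : ℝ) ^ ((T.card : ℝ) - m - t)) with hc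
  calc ν (E ∩ Metric.closedBall 0 R)
      = ∫⁻ _ in E ∩ Metric.closedBall 0 R, 1 ∂ν := by simp
    _ ≤ ∫⁻ x in E ∩ Metric.closedBall 0 R, c * κ q (Φ *ᵥ x) {quantizeVec q x} ∂ν := by
        refine setLIntegral_mono' (hE.inter measurableSet_closedBall) fun x hx => ?_
        exact one_le_rpow_mul_of_surprisal_lt prob_le_one hq hx.1
    _ ≤ ∫⁻ x in Metric.closedBall 0 R, c * κ q (Φ *ᵥ x) {quantizeVec q x} ∂ν :=
        lintegral_mono_set Set.inter_subset_right
    _ = c * ∫⁻ x in Metric.closedBall 0 R, κ q (Φ *ᵥ x) {quantizeVec q x} ∂ν :=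
        lintegral_const_mul _ (measurable_kernel_mulVec_quantizeVec Φ κ q)
    _ ≤ c * (ν (Metric.closedBall 0 (R + 1)) *
          ENNReal.ofReal ((1 / (q : ℝ)) ^ Module.finrank ℝ (kernelOn Φ T))) := by
        gcongr
        exact setLIntegral_kernel_quantizeVec_le (by omega) Φ _
          (fun v hv => (mem_kernelOn.1 hv).2) ν hν (κ q) R
    _ = ν (Metric.closedBall 0 (R + 1)) *
          (c * ENNReal.ofReal ((1 / (q : ℝ)) ^ Module.finrank ℝ (kernelOn Φ T))) := by ring
    _ ≤ _ := by
        gcongr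
        rw [hc, ← ENNReal.ofReal_mul (by positivity)]
        refine ENNReal.ofReal_le_ofReal ?_
        rw [one_div, inv_pow, ← Real.rpow_natCast, ← Real.rpow_neg hq0.le,
          ← Real.rpow_add hq0]
        refine Real.rpow_le_rpow_of_exponent_le hq1 ?_
        have : (T.card : ℝ) ≤ m + Module.finrank ℝ (kernelOn Φ T) := by
          exact_mod_cast card_le_add_finrank_kernelOn Φ T
        linarith

theorem tendsto_measure_guessableSet {T : Finset (Fin n)} {t : ℝ≥0} (ht : 0 < t)
    (μ : Fin n → Measure ℝ) [∀ i, IsFiniteMeasure (μ i)] (hμ : ∀ i ∈ T, μ i ≪ volume) :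
    Tendsto (fun q => Measure.pi μ (guessableSet Φ κ t T.card q)) atTop (𝓝 0) := by
  classical
  -- Lebesgue measure on the coordinates in `T` and the given measures elsewhere: the product
  -- dominates `Measure.pi μ` and is invariant under `kernelOn Φ T`, whose vectors vanish off `T`.
  set b : Fin n → Measure ℝ := fun i => if i ∈ T then volume else μ i with hb
  have hbs : ∀ i, SigmaFinite (b i) := fun i => by
    by_cases hi : i ∈ T
    · simp only [hb, if_pos hi]; infer_instance
    · simp only [hb, if_neg hi]; infer_instance
  have hbl : ∀ i, IsLocallyFiniteMeasure (b i) := fun i => by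
    by_cases hi : i ∈ T
    · simp only [hb, if_pos hi]; infer_instance
    · simp only [hb, if_neg hi]; infer_instance
  have hac : Measure.pi μ ≪ Measure.pi b := by
    refine pi_absolutelyContinuous_pi _ _ fun i => ?_
    by_cases hi : i ∈ T
    · simpa [hb, hi] using hμ i hi
    · simpa [hb, hi] using Measure.AbsolutelyContinuous.rfl
  have hinv : ∀ v ∈ kernelOn Φ T,
      MeasurePreserving (fun x => x + v) (Measure.pi b) (Measure.pi b) := by
    intro v hv
    refine measurePreserving_pi b b (f := fun i x => x + v i) fun i => ?_
    by_cases hi : i ∈ T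
    · simpa [hb, hi] using measurePreserving_add_right volume (v i)
    · have h0 : v i = 0 := (mem_kernelOn.1 hv).1 i hi
      simp only [h0, add_zero]
      exact MeasurePreserving.id (b i)
  have hball : ∀ R : ℝ, Tendsto (fun q => Measure.pi μ
      (guessableSet Φ κ t T.card q ∩ Metric.closedBall 0 R)) atTop (𝓝 0) := by
    intro R
    refine tendsto_measure_zero_of_absolutelyContinuous hac
      (fun q => (measurableSet_guessableSet Φ κ t T.card q).inter measurableSet_closedBall) ?_
    have hlim : Tendsto (fun q : ℕ => Measure.pi b (Metric.closedBall 0 (R + 1)) *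
        ENNReal.ofReal ((q : ℝ) ^ (-(t : ℝ)))) atTop (𝓝 0) := by
      have h1 : Tendsto (fun q : ℕ => ENNReal.ofReal ((q : ℝ) ^ (-(t : ℝ)))) atTop (𝓝 0) := by
        have := (tendsto_rpow_neg_atTop (y := (t : ℝ)) (by exact_mod_cast ht)).comp
          tendsto_natCast_atTop_atTop
        simpa using ENNReal.tendsto_ofReal this
      have h2 : Measure.pi b (Metric.closedBall 0 (R + 1)) ≠ ⊤ := measure_closedBall_lt_top.ne
      simpa using ENNReal.Tendsto.const_mul h1 (Or.inr h2)
    refine tendsto_of_tendsto_of_tendsto_of_le_of_le' tendsto_const_nhds hlim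
      (Eventually.of_forall fun _ => zero_le) ?_
    filter_upwards [eventually_ge_atTop 2] with q hq
    exact measure_guessableSet_inter_le Φ κ t hq (Measure.pi b) hinv R
  rw [ENNReal.tendsto_nhds_zero]
  intro η hη
  have hη2 : 0 < η / 2 := ENNReal.half_pos hη.ne'
  obtain ⟨R, hR⟩ := ((ENNReal.tendsto_nhds_zero.1
    (tendsto_measure_compl_closedBall (Measure.pi μ))) _ hη2).exists
  filter_upwards [ENNReal.tendsto_nhds_zero.1 (hball R) _ hη2] with q hq
  calc Measure.pi μ (guessableSet Φ κ t T.card q)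
      ≤ Measure.pi μ (guessableSet Φ κ t T.card q ∩ Metric.closedBall 0 (R : ℝ)) +
        Measure.pi μ (Metric.closedBall 0 (R : ℝ))ᶜ := by
        refine (measure_mono fun x hx => ?_).trans (measure_union_le _ _)
        by_cases h : x ∈ Metric.closedBall (0 : Fin n → ℝ) (R : ℝ)
        · exact Or.inl ⟨hx, h⟩
        · exact Or.inr h
    _ ≤ η / 2 + η / 2 := add_le_add hq hR
    _ = η := ENNReal.add_halves η

/-- Splitting by which coordinates lie outside `S` reduces to absolutely continuous factors on `T`.
Only finitely many patterns occur, so the union of their exceptional sets still has vanishing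
measure. Half of `t` is spent in the threshold, half on the exceptional set. -/
theorem lower_bound (p : Measure ℝ) [IsProbabilityMeasure p] {S : Set ℝ} (hS : MeasurableSet S)
    (hac : p.restrict Sᶜ ≪ volume) {t : ℝ≥0} (ht : 0 < t) :
    ∀ᶠ q : ℕ in atTop, n * p Sᶜ ≤ m + t +
      (∫⁻ x, surprisal (κ q (Φ *ᵥ x) {quantizeVec q x}) ∂(Measure.pi fun _ : Fin n => p)) /
        ENNReal.ofReal (Real.logb 2 q) := by
  classical
  set μ := Measure.pi fun _ : Fin n => p with hμ
  set patt : (Fin n → ℝ) → Finset (Fin n) :=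
    fun x => Finset.univ.filter fun i => x i ∉ S with hpatt
  set B : Finset (Fin n) → Set (Fin n → ℝ) :=
    fun T => Set.univ.pi fun i => if i ∈ T then Sᶜ else S with hB
  have hmem : ∀ x, x ∈ B (patt x) := by
    intro x i _
    by_cases h : x i ∈ S <;> simp [hpatt, h]
  set E : ℕ → Set (Fin n → ℝ) :=
    fun q => ⋃ T, B T ∩ guessableSet Φ κ (t / 2) T.card q with hE
  have hBm : ∀ T, MeasurableSet (B T) := fun T => by
    refine MeasurableSet.univ_pi fun i => ?_
    split_ifs
    exacts [hS.compl, hS]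
  have hEm : ∀ q, MeasurableSet (E q) := fun q =>
    MeasurableSet.iUnion fun T => (hBm T).inter (measurableSet_guessableSet _ _ _ _ _)
  have hT : ∀ T, Tendsto (fun q => μ (B T ∩ guessableSet Φ κ (t / 2) T.card q)) atTop (𝓝 0) := by
    intro T
    have h1 := tendsto_measure_guessableSet Φ κ (T := T) (t := t / 2) (by positivity)
      -- Restricting the product to the box `B T` restricts each factor, which makes the factors in
      -- `T` absolutely continuous.
      (fun i => p.restrict (if i ∈ T then Sᶜ else S)) fun i hi => by simpa [hi] using hac
    refine h1.congr fun q => ?_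
    rw [← Measure.restrict_pi_pi, Measure.restrict_apply (measurableSet_guessableSet _ _ _ _ _),
      Set.inter_comm]
  have hElim : Tendsto (fun q => n * μ (E q)) atTop (𝓝 0) := by
    have h1 : Tendsto (fun q => n * ∑ T, μ (B T ∩ guessableSet Φ κ (t / 2) T.card q)) atTop
        (𝓝 0) := by
      have := ENNReal.Tendsto.const_mul (a := (n : ℝ≥0∞))
        (tendsto_finsetSum Finset.univ fun T _ => hT T)
        (Or.inr (by simp))
      simpa using this
    refine tendsto_of_tendsto_of_tendsto_of_le_of_le tendsto_const_nhds h1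
      (fun _ => zero_le) fun q => ?_
    dsimp only
    gcongr
    exact measure_iUnion_fintype_le _ _
  have hcount : ∫⁻ x, ((patt x).card : ℝ≥0∞) ∂μ = n * p Sᶜ := by
    have h1 : ∀ x, ((patt x).card : ℝ≥0∞) = ∑ i, Sᶜ.indicator (fun _ => (1 : ℝ≥0∞)) (x i) := by
      intro x
      simp [hpatt, Finset.card_filter, Set.indicator_apply]
    simp_rw [h1]
    rw [lintegral_finsetSum]
    · have h2 : ∀ i, ∫⁻ x, Sᶜ.indicator (fun _ => (1 : ℝ≥0∞)) (x i) ∂μ = p Sᶜ := by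
        intro i
        rw [(measurePreserving_eval (fun _ : Fin n => p) i).lintegral_comp
          (measurable_const.indicator hS.compl)]
        simp [hS.compl]
      simp [h2]
    · exact fun i _ => (measurable_const.indicator hS.compl).comp (measurable_pi_apply i)
  filter_upwards [ENNReal.tendsto_nhds_zero.1 hElim (t / 2 : ℝ≥0)
    (by exact_mod_cast half_pos ht)] with q hq
  set L := ENNReal.ofReal (Real.logb 2 q)
  set h : (Fin n → ℝ) → ℝ≥0∞ := fun x => surprisal (κ q (Φ *ᵥ x) {quantizeVec q x})
  have hh : Measurable h := measurable_surprisal_kernel Φ κ q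
  -- Off `E q` this negates guessability for the pattern of `x`; on `E q` the trivial bound `|T| ≤
  -- n` suffices.
  have hpt : ∀ x, ((patt x).card : ℝ≥0∞) ≤
      h x / L + ((t / 2 : ℝ≥0) + m) + (E q).indicator (fun _ => (n : ℝ≥0∞)) x := by
    intro x
    by_cases hx : x ∈ E q
    · rw [Set.indicator_of_mem hx]
      refine le_trans ?_ le_add_self
      exact_mod_cast (by simpa using (patt x).card_le_univ)
    · rw [Set.indicator_of_notMem hx, add_zero, ← add_assoc]
      refine le_of_not_gt fun hlt => hx ?_
      exact Set.mem_iUnion.2 ⟨patt x, hmem x, hlt⟩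
  rw [← hcount]
  calc ∫⁻ x, ((patt x).card : ℝ≥0∞) ∂μ
      ≤ ∫⁻ x, (h x / L + ((t / 2 : ℝ≥0) + m) + (E q).indicator (fun _ => (n : ℝ≥0∞)) x) ∂μ :=
        lintegral_mono hpt
    _ = (∫⁻ x, h x ∂μ) / L + ((t / 2 : ℝ≥0) + m) + n * μ (E q) := by
        rw [lintegral_add_left ((hh.div_const _).add_const _), lintegral_add_left (hh.div_const _),
          lintegral_indicator (hEm q)]
        simp only [div_eq_mul_inv]
        rw [lintegral_mul_const _ hh]
        simp
    _ ≤ (∫⁻ x, h x ∂μ) / L + ((t / 2 : ℝ≥0) + m) + (t / 2 : ℝ≥0) := by gcongr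
    _ = m + t + (∫⁻ x, h x ∂μ) / L := by
        have : (t : ℝ≥0∞) = (t / 2 : ℝ≥0) + (t / 2 : ℝ≥0) := by
          rw [← ENNReal.coe_add, add_halves]
        rw [this]
        ring

end LowerBound

/-! ### Upper bound by cross entropy with a reference law. -/

/-- The quantization of an equal mixture of `p` and the standard Gaussian law. -/
noncomputable def referenceLaw (p : Measure ℝ) (q : ℕ) : Measure ℝ :=
  ((2⁻¹ : ℝ≥0∞) • p + (2⁻¹ : ℝ≥0∞) • gaussianReal 0 1).map (quantize q)

instance (p : Measure ℝ) [IsProbabilityMeasure p] (q : ℕ) :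
    IsProbabilityMeasure (referenceLaw p q) := by
  have : IsProbabilityMeasure ((2⁻¹ : ℝ≥0∞) • p + (2⁻¹ : ℝ≥0∞) • gaussianReal 0 1) :=
    ⟨by simp [ENNReal.inv_two_add_inv_two]⟩
  exact Measure.isProbabilityMeasure_map (measurable_quantize q).aemeasurable

theorem referenceLaw_singleton (p : Measure ℝ) (q : ℕ) (x : ℝ) :
    referenceLaw p q {x} = 2⁻¹ * p (quantize q ⁻¹' {x}) +
      2⁻¹ * gaussianReal 0 1 (quantize q ⁻¹' {x}) := by
  rw [referenceLaw, Measure.map_apply (measurable_quantize q) (measurableSet_singleton x)]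
  rfl

theorem atom_le_referenceLaw (p : Measure ℝ) (q : ℕ) (x : ℝ) :
    2⁻¹ * p {x} ≤ referenceLaw p q {quantize q x} := by
  rw [referenceLaw_singleton]
  refine le_trans ?_ le_self_add
  gcongr
  simp

theorem Ico_subset_preimage_quantize {q : ℕ} (hq : 0 < q) (x : ℝ) :
    Set.Ico (quantize q x) (quantize q x + 1 / q) ⊆ quantize q ⁻¹' {quantize q x} := by
  intro z hz
  have hq' : (0 : ℝ) < q := by exact_mod_cast hq
  have h1 : (q : ℝ) * quantize q x = ⌊(q : ℝ) * x⌋ := by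
    unfold quantize
    field_simp
  have h2 : ⌊(q : ℝ) * z⌋ = ⌊(q : ℝ) * x⌋ := by
    rw [Int.floor_eq_iff, ← h1]
    constructor
    · exact mul_le_mul_of_nonneg_left hz.1 hq'.le
    · calc (q : ℝ) * z < q * (quantize q x + 1 / q) := mul_lt_mul_of_pos_left hz.2 hq'
        _ = q * quantize q x + 1 := by field_simp
  simp [quantize, h2]

theorem gaussian_cell_le {q : ℕ} (hq : 0 < q) (x : ℝ) :
    ENNReal.ofReal ((√(2 * Real.pi))⁻¹ * Real.exp (-(x ^ 2 + 1)) / q) ≤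
      gaussianReal 0 1 (quantize q ⁻¹' {quantize q x}) := by
  have hq1 : (1 : ℝ) ≤ q := by exact_mod_cast hq
  rw [gaussianReal_apply 0 one_ne_zero]
  set g := (√(2 * Real.pi))⁻¹ * Real.exp (-(x ^ 2 + 1)) with hg
  have hcell : MeasurableSet (quantize q ⁻¹' {quantize q x}) :=
    measurable_quantize q (measurableSet_singleton _)
  calc ENNReal.ofReal (g / q)
      = ENNReal.ofReal g * volume (Set.Ico (quantize q x) (quantize q x + 1 / q)) := by
        rw [Real.volume_Ico, ← ENNReal.ofReal_mul (by positivity)]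
        congr 1
        ring
    _ ≤ ENNReal.ofReal g * volume (quantize q ⁻¹' {quantize q x}) := by
        gcongr
        exact Ico_subset_preimage_quantize hq x
    _ = ∫⁻ _ in quantize q ⁻¹' {quantize q x}, ENNReal.ofReal g := by
        rw [setLIntegral_const]
    _ ≤ _ := by
        refine setLIntegral_mono' hcell fun z hz => ENNReal.ofReal_le_ofReal ?_
        have h1 : |z - x| ≤ 1 := by
          refine (abs_sub_le_of_quantize_eq hq hz).trans ?_
          rw [div_le_one (by positivity)]
          exact hq1
        -- With `|z - x| ≤ 1` this bounds the Gaussian density below on the whole cell by `g`, which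
        -- depends on `x` only. The difference of the two sides is `2 (1 - (z - x)²) + (z - 2x)²`.
        have h2 : z ^ 2 ≤ 2 * (x ^ 2 + 1) := by
          have := abs_le.1 h1
          nlinarith [sq_nonneg (z - 2 * x)]
        rw [gaussianPDFReal, hg]
        simp only [NNReal.coe_one, mul_one, sub_zero]
        gcongr
        linarith

/-- A bound, up to `log₂ q`, for the information content of a cell under the reference law. -/
noncomputable def excess (x : ℝ) : ℝ :=
  Real.logb 2 (2 * √(2 * Real.pi)) + (x ^ 2 + 1) / Real.log 2

theorem surprisal_referenceLaw_le (p : Measure ℝ) [IsProbabilityMeasure p] {q : ℕ} (hq : 0 < q)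
    (x : ℝ) : surprisal (referenceLaw p q {quantize q x}) ≤
      ENNReal.ofReal (Real.logb 2 q) + ENNReal.ofReal (excess x) := by
  have hq' : (0 : ℝ) < q := by exact_mod_cast hq
  have h1 : ENNReal.ofReal ((2 * √(2 * Real.pi) * q * Real.exp (x ^ 2 + 1))⁻¹) ≤
      referenceLaw p q {quantize q x} := by
    rw [referenceLaw_singleton]
    calc _ = 2⁻¹ * ENNReal.ofReal ((√(2 * Real.pi))⁻¹ * Real.exp (-(x ^ 2 + 1)) / q) := by
          rw [← ENNReal.ofReal_ofNat, ← ENNReal.ofReal_inv_of_pos (by norm_num),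
            ← ENNReal.ofReal_mul (by norm_num), Real.exp_neg]
          congr 1
          field_simp
      _ ≤ 2⁻¹ * gaussianReal 0 1 (quantize q ⁻¹' {quantize q x}) := by
          gcongr
          exact gaussian_cell_le hq x
      _ ≤ _ := le_add_self
  refine (surprisal_anti h1 (measure_ne_top _ _)).trans ?_
  have hpos : 0 < (2 * √(2 * Real.pi) * q * Real.exp (x ^ 2 + 1))⁻¹ := by positivity
  rw [surprisal, if_neg (by simpa using hpos), ENNReal.toReal_ofReal hpos.le, Real.logb_inv,
    neg_neg]
  refine le_trans (ENNReal.ofReal_le_ofReal (le_of_eq ?_)) ENNReal.ofReal_add_le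
  rw [Real.logb_mul (by positivity) (by positivity), Real.logb_mul (by positivity) (by positivity),
    excess]
  have : Real.logb 2 (Real.exp (x ^ 2 + 1)) = (x ^ 2 + 1) / Real.log 2 := by
    rw [Real.logb, Real.log_exp]
  rw [this]
  ring

theorem tendsto_ofReal_logb : Tendsto (fun q : ℕ => ENNReal.ofReal (Real.logb 2 q)) atTop (𝓝 ⊤) :=
  ENNReal.tendsto_ofReal_nhds_top.2
    ((Real.tendsto_logb_atTop (by norm_num)).comp tendsto_natCast_atTop_atTop)

theorem tendsto_div_logb_zero {c : ℝ≥0∞} (hc : c ≠ ⊤) :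
    Tendsto (fun q : ℕ => c / ENNReal.ofReal (Real.logb 2 q)) atTop (𝓝 0) := by
  have := ENNReal.Tendsto.const_div (a := c) tendsto_ofReal_logb (Or.inr hc)
  simpa using this

/-- Reverse Fatou for the normalized surprisal: its pointwise limsup is `0` at atoms, by the `p`
half of the mixture, and at most `1` elsewhere, by the Gaussian half. -/
theorem scalar_upper_bound (p : Measure ℝ) [IsProbabilityMeasure p] {S : Set ℝ}
    (hS : S.Countable) (hmom : ∫⁻ x, ENNReal.ofReal (excess x) ∂p ≠ ⊤) {η : ℝ≥0∞} (hη : 0 < η) :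
    ∀ᶠ q : ℕ in atTop, (∫⁻ x, surprisal (referenceLaw p q {quantize q x}) ∂p) /
      ENNReal.ofReal (Real.logb 2 q) ≤ p Sᶜ + η := by
  set U : ℕ → ℝ → ℝ≥0∞ := fun q x =>
    surprisal (referenceLaw p q {quantize q x}) / ENNReal.ofReal (Real.logb 2 q) with hU
  have hm : ∀ q, Measurable fun x => surprisal (referenceLaw p q {quantize q x}) := fun q =>
    measurable_surprisal.comp
      ((measurable_measure_singleton (referenceLaw p q)).comp (measurable_quantize q))
  have hUm : ∀ q, Measurable (U q) := fun q => (hm q).div_const _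
  have hL : ∀ q : ℕ, 2 ≤ q → 1 ≤ ENNReal.ofReal (Real.logb 2 q) := by
    intro q hq
    rw [ENNReal.one_le_ofReal, ← Real.logb_self_eq_one (b := 2) (by norm_num)]
    exact Real.logb_le_logb_of_le (by norm_num) (by norm_num) (by exact_mod_cast hq)
  have hbound : ∀ q : ℕ, 2 ≤ q → ∀ x,
      U q x ≤ 1 + ENNReal.ofReal (excess x) / ENNReal.ofReal (Real.logb 2 q) := by
    intro q hq x
    calc U q x ≤ (ENNReal.ofReal (Real.logb 2 q) + ENNReal.ofReal (excess x)) /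
          ENNReal.ofReal (Real.logb 2 q) :=
          ENNReal.div_le_div_right (surprisal_referenceLaw_le p (by omega) x) _
      _ ≤ _ := by
          rw [ENNReal.add_div]
          gcongr
          exact ENNReal.div_self_le_one
  -- The shift to `q + 2` keeps `log₂ ≥ 1`, so that `1 + excess` dominates every term of the
  -- sequence.
  have hlim : ∀ᵐ x ∂p, limsup (fun q => U (q + 2) x) atTop ≤ Sᶜ.indicator (fun _ => 1) x := by
    have hpos : ∀ᵐ x ∂p, x ∈ S → p {x} ≠ 0 := by
      have : p {x | x ∈ S ∧ p {x} = 0} = 0 := by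
        refine (measure_null_iff_singleton (hS.mono fun x hx => hx.1)).2 fun x hx => hx.2
      rw [ae_iff]
      simpa using this
    filter_upwards [hpos] with x hx
    by_cases hxS : x ∈ S
    · have hs : surprisal (2⁻¹ * p {x}) ≠ ⊤ := by
        have : 2⁻¹ * p {x} ≠ 0 := mul_ne_zero (by simp) (hx hxS)
        rw [surprisal, if_neg this]
        exact ENNReal.ofReal_ne_top
      have h1 := ((tendsto_div_logb_zero hs).comp (tendsto_add_atTop_nat 2)).limsup_eq
      rw [Set.indicator_of_notMem (by simpa using hxS), ← h1]
      refine limsup_le_limsup (Eventually.of_forall fun q => ?_)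
      exact ENNReal.div_le_div_right
        (surprisal_anti (atom_le_referenceLaw p _ x) (measure_ne_top _ _)) _
    · have h1 := (((tendsto_div_logb_zero (c := ENNReal.ofReal (excess x)) (by simp)).comp
        (tendsto_add_atTop_nat 2)).const_add 1).limsup_eq
      rw [Set.indicator_of_mem (by simpa using hxS), ← add_zero 1, ← h1]
      exact limsup_le_limsup (Eventually.of_forall fun q => hbound _ (by omega) x)
  have hls : limsup (fun q => ∫⁻ x, U (q + 2) x ∂p) atTop ≤ p (Sᶜ) := by
    refine (limsup_lintegral_le (fun x => 1 + ENNReal.ofReal (excess x)) (fun q => hUm _)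
      (fun q => Eventually.of_forall fun x => ?_) ?_).trans ?_
    · refine (hbound _ (by omega) x).trans ?_
      refine add_le_add le_rfl ?_
      exact ENNReal.div_le_of_le_mul (le_mul_of_one_le_right bot_le (hL _ (by omega)))
    · rw [lintegral_add_left measurable_const]
      simpa using hmom
    · refine (lintegral_mono_ae hlim).trans_eq ?_
      simp [lintegral_indicator hS.measurableSet.compl]
  have hlt : limsup (fun q => ∫⁻ x, U (q + 2) x ∂p) atTop < p Sᶜ + η :=
    hls.trans_lt (ENNReal.lt_add_right (measure_ne_top _ _) hη.ne')
  have hev := eventually_lt_of_limsup_lt hlt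
  rw [← map_add_atTop_eq_nat 2, eventually_map]
  filter_upwards [hev] with q hq
  refine le_of_eq_of_le ?_ hq.le
  simp only [hU, div_eq_mul_inv]
  rw [lintegral_mul_const _ (hm _)]

theorem lintegral_excess_ne_top {p : Measure ℝ} [IsProbabilityMeasure p] (h : MemLp id 2 p) :
    ∫⁻ x, ENNReal.ofReal (excess x) ∂p ≠ ⊤ := by
  have h1 : Integrable (fun x : ℝ => x ^ 2) p := by simpa using h.integrable_sq
  have h2 : Integrable excess p := by
    unfold excess
    exact (integrable_const _).add ((h1.add (integrable_const 1)).div_const _)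
  exact h2.lintegral_lt_top.ne

theorem upper_bound (p : Measure ℝ) [IsProbabilityMeasure p] {n : ℕ} (q : ℕ) :
    ∫⁻ x, surprisal ((Measure.pi fun _ : Fin n => referenceLaw p q) {quantizeVec q x})
      ∂(Measure.pi fun _ : Fin n => p) ≤
    n * ∫⁻ x, surprisal (referenceLaw p q {quantize q x}) ∂p := by
  have hm : Measurable fun x => surprisal (referenceLaw p q {quantize q x}) :=
    measurable_surprisal.comp
      ((measurable_measure_singleton (referenceLaw p q)).comp (measurable_quantize q))
  calc _ ≤ ∫⁻ x, ∑ i, surprisal (referenceLaw p q {quantize q (x i)})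
        ∂(Measure.pi fun _ : Fin n => p) := by
        refine lintegral_mono fun x => ?_
        rw [Measure.pi_singleton]
        exact surprisal_prod_le _ _ fun i => measure_ne_top _ _
    _ = ∑ i : Fin n, ∫⁻ x, surprisal (referenceLaw p q {quantize q x}) ∂p := by
        rw [lintegral_finsetSum (f := fun i (x : Fin n → ℝ) =>
          surprisal (referenceLaw p q {quantize q (x i)})) _
          fun i _ => hm.comp (measurable_pi_apply i)]
        exact Finset.sum_congr rfl fun i _ =>
          (measurePreserving_eval (fun _ : Fin n => p) i).lintegral_comp hm
    _ = _ := by simp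

theorem IsNonsingular.exists_countable {p : Measure ℝ} (h : IsNonsingular p) :
    ∃ S : Set ℝ, S.Countable ∧ p.restrict Sᶜ ≪ volume := by
  obtain ⟨δ, pc, pd, -, -, -, hac, -, ⟨S, hS, hpd⟩, rfl⟩ := h
  refine ⟨S, hS, Measure.AbsolutelyContinuous.mk fun A hA h0 => ?_⟩
  have h1 : pc (A ∩ Sᶜ) = 0 := measure_mono_null Set.inter_subset_left (hac h0)
  have h2 : pd (A ∩ Sᶜ) = 0 := measure_mono_null Set.inter_subset_right hpd
  simp [Measure.restrict_apply hA, h1, h2]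

/-! ### Application to the i.i.d. sequence and its measurements. -/

section Sequence

variable {Ω : Type*} [MeasurableSpace Ω] {P : Measure Ω} [IsProbabilityMeasure P]
  {X : ℕ → Ω → ℝ}

theorem measurable_block (hmeas : ∀ i, Measurable (X i)) (N : ℕ) : Measurable (block X N) :=
  measurable_pi_lambda _ fun i => hmeas i

theorem map_block (hmeas : ∀ i, Measurable (X i)) (hindep : iIndepFun X P)
    (hident : ∀ i, IdentDistrib (X i) (X 0) P P) (N : ℕ) :
    P.map (block X N) = Measure.pi fun _ : Fin N => P.map (X 0) := by
  have h := (iIndepFun_iff_map_fun_eq_pi_map (f := fun i : Fin N => X i)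
    fun i => (hmeas i).aemeasurable).1 (hindep.precomp Fin.val_injective)
  have h2 : ∀ i : Fin N, P.map (X i) = P.map (X 0) := fun i => (hident i).map_eq
  simp_rw [h2] at h
  exact h

theorem entropy_quantize_le {X : Ω → ℝ} (hX : Measurable X) (q : ℕ) :
    entropy P (fun ω => quantize q (X ω)) ≤
      ∫⁻ x, surprisal (referenceLaw (P.map X) q {quantize q x}) ∂(P.map X) := by
  have : IsProbabilityMeasure (P.map X) := Measure.isProbabilityMeasure_map hX.aemeasurable
  rw [lintegral_map (f := fun x => surprisal (referenceLaw (P.map X) q {quantize q x})) _ hX]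
  · exact entropy_le_lintegral P _ ((measurable_quantize q).comp hX) (countable_range_quantize q)
      fun ω => ⟨_, rfl⟩
  · exact measurable_surprisal.comp
      ((measurable_measure_singleton _).comp (measurable_quantize q))

theorem entropy_quantizeVec_block_le (hmeas : ∀ i, Measurable (X i)) (hindep : iIndepFun X P)
    (hident : ∀ i, IdentDistrib (X i) (X 0) P P) (N q : ℕ) :
    entropy P (fun ω => quantizeVec q (block X N ω)) ≤
      N * ∫⁻ x, surprisal (referenceLaw (P.map (X 0)) q {quantize q x}) ∂(P.map (X 0)) := by
  have : IsProbabilityMeasure (P.map (X 0)) :=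
    Measure.isProbabilityMeasure_map (hmeas 0).aemeasurable
  refine le_trans ?_ (upper_bound (P.map (X 0)) q)
  rw [← map_block hmeas hindep hident, lintegral_map (f := fun x => surprisal
    ((Measure.pi fun _ : Fin N => referenceLaw (P.map (X 0)) q) {quantizeVec q x})) _
    (measurable_block hmeas N)]
  · exact entropy_le_lintegral P _ ((measurable_quantizeVec q).comp (measurable_block hmeas N))
      (countable_range_quantizeVec q) fun ω => ⟨_, rfl⟩
  · exact measurable_surprisal.comp
      ((measurable_measure_singleton _).comp (measurable_quantizeVec q))

theorem condEntropy_lower_bound (hmeas : ∀ i, Measurable (X i)) (hindep : iIndepFun X P)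
    (hident : ∀ i, IdentDistrib (X i) (X 0) P P) {S : Set ℝ} (hS : MeasurableSet S)
    (hac : (P.map (X 0)).restrict Sᶜ ≪ volume) {N m : ℕ} (Φ : Matrix (Fin m) (Fin N) ℝ)
    {t : ℝ≥0} (ht : 0 < t) :
    ∀ᶠ q : ℕ in atTop, N * P.map (X 0) Sᶜ ≤ m + t +
      condEntropy P (fun ω => quantizeVec q (block X N ω)) (fun ω => Φ *ᵥ block X N ω) /
        ENNReal.ofReal (Real.logb 2 q) := by
  have : IsProbabilityMeasure (P.map (X 0)) :=
    Measure.isProbabilityMeasure_map (hmeas 0).aemeasurable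
  have hb := measurable_block hmeas N
  have hΦ : Measurable fun x : Fin N → ℝ => Φ *ᵥ x :=
    (Continuous.matrix_mulVec continuous_const continuous_id).measurable
  have h := lower_bound Φ (fun q => condDistrib (fun ω => quantizeVec q (block X N ω))
    (fun ω => Φ *ᵥ block X N ω) P) (P.map (X 0)) hS hac ht
  filter_upwards [h] with q hq
  rw [← map_block hmeas hindep hident, lintegral_map
    (measurable_surprisal_kernel Φ (fun q => condDistrib
      (fun ω => quantizeVec q (block X N ω)) (fun ω => Φ *ᵥ block X N ω) P) q) hb] at hq
  rwa [condEntropy_eq_lintegral P (D := fun ω => quantizeVec q (block X N ω))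
    (Y := fun ω => Φ *ᵥ block X N ω) ((measurable_quantizeVec q).comp hb) (hΦ.comp hb)
    (countable_range_quantizeVec q) fun ω => ⟨_, rfl⟩]

/-- The case of one coordinate and no measurements, where the guessing strategy is the constant law
of the quantized variable. -/
theorem entropy_lower_bound (hmeas : ∀ i, Measurable (X i)) (hindep : iIndepFun X P)
    (hident : ∀ i, IdentDistrib (X i) (X 0) P P) {S : Set ℝ} (hS : MeasurableSet S)
    (hac : (P.map (X 0)).restrict Sᶜ ≪ volume) {t : ℝ≥0} (ht : 0 < t) :
    ∀ᶠ q : ℕ in atTop, P.map (X 0) Sᶜ ≤ t +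
      entropy P (fun ω => quantize q (X 0 ω)) / ENNReal.ofReal (Real.logb 2 q) := by
  have : IsProbabilityMeasure (P.map (X 0)) :=
    Measure.isProbabilityMeasure_map (hmeas 0).aemeasurable
  have hb := measurable_block hmeas 1
  have hD : ∀ q, Measurable fun ω => quantizeVec q (block X 1 ω) :=
    fun q => (measurable_quantizeVec q).comp hb
  have hpm : ∀ q, IsProbabilityMeasure (P.map fun ω => quantizeVec q (block X 1 ω)) :=
    fun q => Measure.isProbabilityMeasure_map (hD q).aemeasurable
  have h := lower_bound (0 : Matrix (Fin 0) (Fin 1) ℝ)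
    (fun q => Kernel.const _ (P.map fun ω => quantizeVec q (block X 1 ω)))
    (P.map (X 0)) hS hac ht
  filter_upwards [h] with q hq
  have hq0 : Measurable fun ω => quantize q (X 0 ω) := (measurable_quantize q).comp (hmeas 0)
  have hsurp : ∀ ω, P.map (fun ω => quantizeVec q (block X 1 ω)) {quantizeVec q (block X 1 ω)} =
      P.map (fun ω => quantize q (X 0 ω)) {quantize q (X 0 ω)} := by
    intro ω
    rw [Measure.map_apply (hD q) (measurableSet_singleton _),
      Measure.map_apply hq0 (measurableSet_singleton _)]
    congr 1
    ext ω'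
    simp [funext_iff, quantizeVec, block]
  rw [← map_block hmeas hindep hident, lintegral_map
    (measurable_surprisal_kernel _ (fun q => Kernel.const _
      (P.map fun ω => quantizeVec q (block X 1 ω))) q) hb] at hq
  simp only [Kernel.const_apply, hsurp, Nat.cast_one, Nat.cast_zero, one_mul, zero_add] at hq
  rwa [entropy_eq_lintegral P hq0 (countable_range_quantize q) fun ω => ⟨_, rfl⟩]

theorem hasRID (hmeas : ∀ i, Measurable (X i)) (hindep : iIndepFun X P)
    (hident : ∀ i, IdentDistrib (X i) (X 0) P P) {S : Set ℝ} (hS : S.Countable)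
    (hac : (P.map (X 0)).restrict Sᶜ ≪ volume)
    (hmom : ∫⁻ x, ENNReal.ofReal (excess x) ∂(P.map (X 0)) ≠ ⊤) :
    HasRID P (X 0) (P.map (X 0) Sᶜ).toNNReal := by
  have : IsProbabilityMeasure (P.map (X 0)) :=
    Measure.isProbabilityMeasure_map (hmeas 0).aemeasurable
  rw [HasRID, ENNReal.coe_toNNReal (measure_ne_top _ _),
    ENNReal.tendsto_nhds (measure_ne_top _ _)]
  intro η hη
  obtain ⟨t, ht0, htη⟩ := ENNReal.lt_iff_exists_nnreal_btwn.1 hη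
  filter_upwards [scalar_upper_bound (P.map (X 0)) hS hmom hη,
    entropy_lower_bound hmeas hindep hident hS.measurableSet hac (ENNReal.coe_pos.1 ht0)]
    with q hu hl
  constructor
  · rw [tsub_le_iff_left]
    exact hl.trans (by gcongr)
  · exact (ENNReal.div_le_div_right (entropy_quantize_le (hmeas 0) q) _).trans hu

theorem le_rows_div_size (hmeas : ∀ i, Measurable (X i)) (hindep : iIndepFun X P)
    (hident : ∀ i, IdentDistrib (X i) (X 0) P P) {S : Set ℝ} (hS : S.Countable)
    (hac : (P.map (X 0)).restrict Sᶜ ≪ volume)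
    (hmom : ∫⁻ x, ENNReal.ofReal (excess x) ∂(P.map (X 0)) ≠ ⊤) {N m : ℕ} (hN : 0 < N)
    (Φ : Matrix (Fin m) (Fin N) ℝ) {ε : ℝ}
    (hε : limsup (fun q : ℕ =>
      ((condEntropy P (fun ω => quantizeVec q (block X N ω)) (fun ω => Φ *ᵥ block X N ω)
        / entropy P (fun ω => quantizeVec q (block X N ω)) : ℝ≥0∞) : EReal)) atTop
      ≤ (ε : EReal)) :
    (P.map (X 0) Sᶜ).toNNReal * (1 - ε) ≤ (m : ℝ) / N := by
  have : IsProbabilityMeasure (P.map (X 0)) :=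
    Measure.isProbabilityMeasure_map (hmeas 0).aemeasurable
  set d : ℝ≥0 := (P.map (X 0) Sᶜ).toNNReal with hd
  have hpd : P.map (X 0) Sᶜ = d := (ENNReal.coe_toNNReal (measure_ne_top _ _)).symm
  have hN' : (0 : ℝ) < N := by exact_mod_cast hN
  -- The ratios are nonnegative, so a negative `ε` cannot bound their limsup.
  have hε0 : 0 ≤ ε := by
    by_contra hneg
    obtain ⟨q, hq⟩ := (eventually_lt_of_limsup_lt
      (hε.trans_lt (EReal.coe_lt_coe_iff.2 (not_le.1 hneg)))).exists
    exact absurd hq (not_lt.2 (EReal.coe_ennreal_nonneg _))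
  by_contra hlt
  rw [not_le, div_lt_iff₀ hN'] at hlt
  have hdN : 0 ≤ (d : ℝ) * N := by positivity
  obtain ⟨ε', hε', hgap⟩ : ∃ ε' > ε, (m : ℝ) + ε' * (d * N) < d * N := by
    set g := d * (1 - ε) * N - m with hg
    refine ⟨ε + g / (2 * (d * N + 1)), ?_, ?_⟩
    · have : 0 < g := by linarith
      have : 0 < g / (2 * (d * N + 1)) := by positivity
      linarith
    · have hg0 : 0 < g := by linarith
      have : g / (2 * (d * N + 1)) * (d * N) < g := by
        rw [div_mul_eq_mul_div, div_lt_iff₀ (by positivity)]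
        nlinarith
      nlinarith
  have hε'0 : 0 < ε' := hε0.trans_lt hε'
  -- The total coefficient of `t` is `1 + ε' N`; the witness uses up half of the gap `g`.
  obtain ⟨t, ht, hgap'⟩ : ∃ t : ℝ, 0 < t ∧ (m : ℝ) + t + ε' * (N * (d + t)) < d * N := by
    set g := d * N - (m + ε' * (d * N)) with hg
    have hg0 : 0 < g := by linarith
    refine ⟨g / (2 * (1 + ε' * N)), by positivity, ?_⟩
    have : g / (2 * (1 + ε' * N)) * (1 + ε' * N) = g / 2 := by field_simp
    linarith
  lift t to ℝ≥0 using ht.le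
  rw [NNReal.coe_pos] at ht
  have hratio := eventually_lt_of_limsup_lt (hε.trans_lt (EReal.coe_lt_coe_iff.2 hε'))
  obtain ⟨q, hr, hl, hu⟩ := (hratio.and
    ((condEntropy_lower_bound hmeas hindep hident hS.measurableSet hac Φ ht).and
    (scalar_upper_bound (P.map (X 0)) hS hmom (ENNReal.coe_pos.2 ht)))).exists
  set L := ENNReal.ofReal (Real.logb 2 q)
  set c := condEntropy P (fun ω => quantizeVec q (block X N ω)) (fun ω => Φ *ᵥ block X N ω)
  set e := entropy P (fun ω => quantizeVec q (block X N ω)) with he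
  -- Finiteness of `ε'` excludes `e = 0 < c`, where the ratio is `⊤`; positivity of `ε'` covers `e =
  -- ⊤`.
  have hr' : c ≤ ENNReal.ofReal ε' * e := by
    have h1 : ((ENNReal.ofReal ε' : ℝ≥0∞) : EReal) = (ε' : EReal) := by
      rw [EReal.coe_ennreal_ofReal, max_eq_left hε'0.le]
    rw [← h1, EReal.coe_ennreal_lt_coe_ennreal_iff] at hr
    exact (ENNReal.div_le_iff_le_mul (Or.inr ENNReal.ofReal_ne_top)
      (Or.inr (by simpa using hε'0))).1 hr.le
  have hfin : (N : ℝ≥0∞) * d ≤ m + t + ENNReal.ofReal ε' * (N * (d + t)) := by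
    rw [hpd] at hl hu
    refine hl.trans ?_
    gcongr
    calc c / L ≤ ENNReal.ofReal ε' * (N * ∫⁻ x, surprisal (referenceLaw (P.map (X 0)) q
          {quantize q x}) ∂(P.map (X 0))) / L := by
          refine ENNReal.div_le_div_right (hr'.trans ?_) _
          gcongr
          exact entropy_quantizeVec_block_le hmeas hindep hident N q
      _ = ENNReal.ofReal ε' * (N * ((∫⁻ x, surprisal (referenceLaw (P.map (X 0)) q
          {quantize q x}) ∂(P.map (X 0))) / L)) := by
          simp only [div_eq_mul_inv, mul_assoc]
      _ ≤ _ := by gcongr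
  have hreal : (N : ℝ) * d ≤ m + t + ε' * (N * (d + t)) := by
    lift ε' to ℝ≥0 using hε'0.le
    rw [ENNReal.ofReal_coe_nnreal] at hfin
    exact_mod_cast hfin
  linarith

end Sequence

end A2A

theorem mainTheorem5 {Ω : Type*} [MeasurableSpace Ω] (P : Measure Ω) [IsProbabilityMeasure P]
    (X : ℕ → Ω → ℝ) (hmeas : ∀ i, Measurable (X i)) (hindep : iIndepFun X P)
    (hident : ∀ i, IdentDistrib (X i) (X 0) P P)
    (hns : A2A.IsNonsingular (P.map (X 0))) (hmom : MemLp (X 0) 2 P) :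
    ∃ d : ℝ≥0, A2A.HasRID P (X 0) d ∧
      ∀ (F : A2A.MeasurementFamily) (ε : ℝ) (ρ : EReal), F.IsREP P X ε ρ →
        (((d : ℝ) * (1 - ε) : ℝ) : EReal) ≤ ρ := by
  have : IsProbabilityMeasure (P.map (X 0)) :=
    Measure.isProbabilityMeasure_map (hmeas 0).aemeasurable
  obtain ⟨S, hS, hac⟩ := hns.exists_countable
  have hexc : ∫⁻ x, ENNReal.ofReal (A2A.excess x) ∂(P.map (X 0)) ≠ ⊤ :=
    A2A.lintegral_excess_ne_top
      ((memLp_map_measure_iff aestronglyMeasurable_id (hmeas 0).aemeasurable).2 hmom)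
  refine ⟨_, A2A.hasRID hmeas hindep hident hS hac hexc, fun F ε ρ hF => ?_⟩
  rw [← hF.2, A2A.MeasurementFamily.rate]
  -- The bound holds for every member of the family, so it passes to the limsup whatever its value.
  refine le_limsup_of_frequently_le (Frequently.of_forall fun k => ?_)
  exact EReal.coe_le_coe_iff.2 (A2A.le_rows_div_size hmeas hindep hident hS hac hexc
    (F.size_pos k) (F.mat k) (hF.1 k))
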